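/- Let $A\in\mathbb R^{m\times n}$, $b\in\mathbb R^m$, $c\in\mathbb R^n$, $B\in\mathbb R^{r\times n}$, and let $\mathcal K=\{x\in\mathbb R^n: Ax=b,\ x\ge 0\}$ be nonempty and bounded; assume that $x\mapsto -\tfrac12 x^{\top}B^{\top}Bx+c^{\top}x$ is not constant on $\mathcal K$. Write $\|\cdot\|$ for the Euclidean norm and $\|B\|_{\mathrm{op}}$ for the corresponding operator norm, $\mathsf H(x)=-\sum_{l=1}^n x_l\log x_l$ (with $0\log 0=0$) for $x\ge 0$, and $$R_1=\max_{x\in\mathcal K}\|x\|_1,\qquad R_{\mathsf H}=\max_{x,x'\in\mathcal K}\{\mathsf H(x)-\mathsf H(x')\}.$$ For $\varepsilon>0$ and $u\in\mathbb R^r$ let $$g_\varepsilon(u)=\tfrac12\|u\|^2+\min_{x\in\mathcal K}\{(c-B^{\top}u)^{\top}x-\varepsilon\mathsf H(x)\}.$$ Let $v^{(1)},\dots,v^{(V)}$ be the vertices of $\mathcal K$ and, for $i\in\{1,\dots,V\}$, let $$\mathcal C_i=\{u\in\mathbb R^r:(c-B^{\top}u)^{\top}v^{(i)}\le (c-B^{\top}u)^{\top}v^{(j)}\text{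 for all }j\},\qquad D_i=\operatorname{dist}(Bv^{(i)},\operatorname{bd}(\mathcal C_i)),$$ where the distance to the empty set is $+\infty$. For $\gamma>0$ let $$K_i(\gamma)=\min\Big\{\gamma\min_{k:\,Bv^{(k)}\ne Bv^{(i)}}\|Bv^{(k)}-Bv^{(i)}\|,\ \min_{k:\,Bv^{(k)}=Bv^{(i)},\ c^{\top}v^{(k)}\ne c^{\top}v^{(i)}}c^{\top}(v^{(k)}-v^{(i)})\Big\},$$ where a minimum over the empty set is $+\infty$. Fix $i\in\{1,\dots,V\}$, $\gamma>0$, $0<\delta<4\|B\|_{\mathrm{op}}R_1$ and $$0<\varepsilon<K_i(\gamma)\Big(R_1+R_{\mathsf H}-R_1\log\Big(\frac{\delta}{4\|B\|_{\mathrm{op}}R_1}\Big)\Big)^{-1}.$$ Then $g_\varepsilon$ is differentiable on $\mathbb R^r$, and the following hold. 1. Suppose that $Bv^{(i)}\in\operatorname{int}(\mathcal C_i)$, $\gamma<D_i/2$ and $\delta<D_i$. Then every $u\in\mathcal C_i$ with $\|u-Bv^{(i)}\|\le\delta/2$ satisfies $\|\nabla g_\varepsilon(u)\|\le\delta$. Furthermore,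 every $u\in\mathcal C_i$ with $\|\nabla g_\varepsilon(u)\|\le\delta$ satisfies either (a) $\operatorname{dist}(u,\operatorname{bd}(\mathcal C_i))\ge\gamma$ and $\|u-Bv^{(i)}\|<3\delta/2$, or (b) $\operatorname{dist}(u,\operatorname{bd}(\mathcal C_i))<\gamma$. Finally, if $\delta<D_i/3$, then the ball $\{u\in\mathbb R^r:\|u-Bv^{(i)}\|<3\delta/2\}$ is disjoint from $\{u\in\mathbb R^r:\operatorname{dist}(u,\operatorname{bd}(\mathcal C_i))<\gamma\}$; in particular, the sets of points satisfying (a) and (b) are disjoint. 2. Suppose that $Bv^{(i)}\notin\operatorname{int}(\mathcal C_i)$ and $\delta\le\tfrac23\gamma$. Then every $u\in\mathcal C_i$ with $\|\nabla g_\varepsilon(u)\|\le\delta$ satisfies $\operatorname{dist}(u,\operatorname{bd}(\mathcal C_i))<\gamma$. -/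

import Mathlib

open scoped RealInnerProductSpace

namespace EntropicQP

noncomputable section

/-- Multiplication of a vector by a matrix, between Euclidean spaces. -/
abbrev mulE {p q : ℕ} (T : Matrix (Fin p) (Fin q) ℝ) (x : EuclideanSpace ℝ (Fin q)) :
    EuclideanSpace ℝ (Fin p) :=
  Matrix.toEuclideanLin T x

/-- The operator norm of a matrix with respect to the Euclidean norms. -/
def opNorm {p q : ℕ} (T : Matrix (Fin p) (Fin q) ℝ) : ℝ :=
  ‖LinearMap.toContinuousLinearMap (Matrix.toEuclideanLin T)‖

/-- The feasible set `{x : A x = b, x ≥ 0}`. -/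
def feasible {m n : ℕ} (A : Matrix (Fin m) (Fin n) ℝ) (b : EuclideanSpace ℝ (Fin m)) :
    Set (EuclideanSpace ℝ (Fin n)) :=
  {x | mulE A x = b ∧ ∀ l, 0 ≤ x l}

/-- The entropy `-∑ x_l log x_l` (with `0 log 0 = 0`). It is only ever evaluated at points with
nonnegative coordinates, so the value `-∞` off the nonnegative orthant is not needed. -/
def entropy {n : ℕ} (x : EuclideanSpace ℝ (Fin n)) : ℝ :=
  ∑ l, Real.negMulLog (x l)

/-- The quadratic objective `-(1/2) xᵀ (Bᵀ B) x + cᵀ x`. -/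
def quadObjective {n r : ℕ} (c : EuclideanSpace ℝ (Fin n)) (B : Matrix (Fin r) (Fin n) ℝ)
    (x : EuclideanSpace ℝ (Fin n)) : ℝ :=
  -(1 / 2) * ⟪x, mulE (B.transpose * B) x⟫ + ⟪c, x⟫

/-- `max_{x, x' ∈ K} (H(x) - H(x'))`, attained when `K` is nonempty and compact. -/
def entropyRange {n : ℕ} (K : Set (EuclideanSpace ℝ (Fin n))) : ℝ :=
  sSup {t | ∃ x ∈ K, ∃ x' ∈ K, t = entropy x - entropy x'}

/-- `max_{x ∈ K} ‖x‖₁`, attained when `K` is nonempty and compact. -/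
def radiusOne {n : ℕ} (K : Set (EuclideanSpace ℝ (Fin n))) : ℝ :=
  sSup {t | ∃ x ∈ K, t = ∑ l, |x l|}

/-- The variational objective
`g_ε(u) = (1/2)‖u‖² + min_{x ∈ K} ((c - Bᵀ u)ᵀ x - ε H(x))`. -/
def varObjective {n r : ℕ} (K : Set (EuclideanSpace ℝ (Fin n))) (c : EuclideanSpace ℝ (Fin n))
    (B : Matrix (Fin r) (Fin n) ℝ) (ε : ℝ) (u : EuclideanSpace ℝ (Fin r)) : ℝ :=
  1 / 2 * ‖u‖ ^ 2 +
    sInf ((fun x => ⟪c - mulE B.transpose u, x⟫ - ε * entropy x) '' K)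

/-- The region of all `u` for which the vertex `v` of `K` is optimal among all vertices of `K`
(the extreme points of `K`) for the linear cost `c - Bᵀ u`. -/
def region {n r : ℕ} (K : Set (EuclideanSpace ℝ (Fin n))) (c : EuclideanSpace ℝ (Fin n))
    (B : Matrix (Fin r) (Fin n) ℝ) (v : EuclideanSpace ℝ (Fin n)) :
    Set (EuclideanSpace ℝ (Fin r)) :=
  {u | ∀ w ∈ K.extremePoints ℝ, ⟪c - mulE B.transpose u, v⟫ ≤ ⟪c - mulE B.transpose u, w⟫}

/-- The distance from a point to the boundary of the region of `v`; it is `∞` if that boundary is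
empty. -/
def bdDist {n r : ℕ} (K : Set (EuclideanSpace ℝ (Fin n))) (c : EuclideanSpace ℝ (Fin n))
    (B : Matrix (Fin r) (Fin n) ℝ) (v : EuclideanSpace ℝ (Fin n))
    (u : EuclideanSpace ℝ (Fin r)) : ENNReal :=
  Metric.infEDist u (frontier (region K c B v))

/-- The constant
`min {γ min_{Bw ≠ Bv} ‖Bw - Bv‖, min_{Bw = Bv, cᵀw ≠ cᵀv} cᵀ(w - v)}`,
with `w` ranging over the vertices of `K`. A minimum over the empty set is `+∞`. -/
def gapConst {n r : ℕ} (K : Set (EuclideanSpace ℝ (Fin n))) (c : EuclideanSpace ℝ (Fin n))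
    (B : Matrix (Fin r) (Fin n) ℝ) (v : EuclideanSpace ℝ (Fin n)) (γ : ℝ) : EReal :=
  min
    (⨅ w ∈ {w | w ∈ K.extremePoints ℝ ∧ mulE B w ≠ mulE B v},
      ((γ * ‖mulE B w - mulE B v‖ : ℝ) : EReal))
    (⨅ w ∈ {w | w ∈ K.extremePoints ℝ ∧ mulE B w = mulE B v ∧ ⟪c, w⟫ ≠ ⟪c, v⟫},
      ((⟪c, w - v⟫ : ℝ) : EReal))

end

end EntropicQP

open EntropicQP

namespace EntropicQP

open Filter Topology

/-! ### Matrix action and norm estimates in Euclidean space. -/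

section Euclidean

variable {n r : ℕ}

/-! Strict concavity of the entropy gives a unique penalized minimizer `X u`, continuous in `u`, and
the envelope theorem gives `∇g_ε(u) = u - B (X u)`. All estimates then follow from one fact
(`norm_mulE_minimizer_sub_lt`): at depth at least `γ` in the region of `v`, `B (X u)` lies within `δ
/ 2` of `B v`.

For this fact, a ball of radius `γ` inside the region forces every vertex that differs from `v` in
`B` or `c` to be suboptimal by at least `gapConst`. Write `X u = s f + t h`, with `f` in the hull of
the vertices agreeing with `v` and `h` in the hull of the others. Moving to `f` saves linear cost
`t` times the gap and loses at most `ε t (R₁ + R_H - R₁ log t)`, so minimality bounds the gap by `ε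
(R₁ + R_H - R₁ log t)`. The bound on `ε` thus makes `t` small, and `B (X u) - B v = t (B h - B v)`.
The rest is the triangle inequality and the 1-Lipschitz distance to the boundary. -/

theorem inner_mulE_transpose (B : Matrix (Fin r) (Fin n) ℝ) (u : EuclideanSpace ℝ (Fin r))
    (x : EuclideanSpace ℝ (Fin n)) : ⟪mulE B.transpose u, x⟫ = ⟪u, mulE B x⟫ := by
  have h := Matrix.toEuclideanLin_conjTranspose_eq_adjoint B
  rw [Matrix.conjTranspose_eq_transpose_of_trivial] at h
  rw [mulE, h, LinearMap.adjoint_inner_left]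

theorem inner_reducedCost (B : Matrix (Fin r) (Fin n) ℝ) (c x : EuclideanSpace ℝ (Fin n))
    (u : EuclideanSpace ℝ (Fin r)) :
    ⟪c - mulE B.transpose u, x⟫ = ⟪c, x⟫ - ⟪u, mulE B x⟫ := by
  rw [inner_sub_left, inner_mulE_transpose]

theorem norm_mulE_le (B : Matrix (Fin r) (Fin n) ℝ) (x : EuclideanSpace ℝ (Fin n)) :
    ‖mulE B x‖ ≤ opNorm B * ‖x‖ :=
  (LinearMap.toContinuousLinearMap (Matrix.toEuclideanLin B)).le_opNorm x

theorem opNorm_nonneg (B : Matrix (Fin r) (Fin n) ℝ) : 0 ≤ opNorm B := norm_nonneg _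

theorem continuous_mulE (B : Matrix (Fin r) (Fin n) ℝ) : Continuous (mulE B) :=
  (Matrix.toEuclideanLin B).continuous_of_finiteDimensional

theorem norm_le_sum_abs (x : EuclideanSpace ℝ (Fin n)) : ‖x‖ ≤ ∑ l, |x l| := by
  rw [EuclideanSpace.norm_eq]
  refine Real.sqrt_le_iff.mpr ⟨Finset.sum_nonneg fun _ _ => abs_nonneg _, ?_⟩
  simpa using Finset.sum_sq_le_sq_sum_of_nonneg (s := Finset.univ) (f := fun l => |x l|)
    fun _ _ => abs_nonneg _

theorem continuous_entropy : Continuous (entropy (n := n)) := by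
  unfold entropy
  exact continuous_finsetSum _ fun l _ => Real.continuous_negMulLog.comp (by fun_prop)

end Euclidean

/-! ### Polyhedral structure: finitely many vertices, which span the feasible set. -/

section Feasible

variable {m n : ℕ} {A : Matrix (Fin m) (Fin n) ℝ} {b : EuclideanSpace ℝ (Fin m)}

theorem convex_feasible : Convex ℝ (feasible A b) := by
  rintro x ⟨hx, hx0⟩ y ⟨hy, hy0⟩ s t hs ht hst
  refine ⟨?_, fun l => ?_⟩
  · simp only [mulE, map_add, map_smul] at hx hy ⊢
    rw [hx, hy, ← add_smul, hst, one_smul]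
  · simpa using add_nonneg (mul_nonneg hs (hx0 l)) (mul_nonneg ht (hy0 l))

theorem isClosed_feasible : IsClosed (feasible A b) := by
  have h : feasible A b = {x | mulE A x = b} ∩ ⋂ l, {x | 0 ≤ x l} := by
    ext x; simp [feasible]
  rw [h]
  refine (isClosed_eq (continuous_mulE A) continuous_const).inter (isClosed_iInter fun l => ?_)
  exact isClosed_le continuous_const (by fun_prop)

/-- An extreme point of the feasible set is the only feasible point supported on its support. -/
theorem eq_of_support_subset {x y : EuclideanSpace ℝ (Fin n)}
    (hx : x ∈ (feasible A b).extremePoints ℝ) (hy : y ∈ feasible A b)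
    (hxy : ∀ l, x l = 0 → y l = 0) : y = x := by
  -- For small `t` the point `(1 + t) x - t y` beyond `x` stays nonnegative, which puts `x` strictly
  -- between it and `y`.
  obtain ⟨t, ht, ht1⟩ : ∃ t : ℝ, 0 < t ∧ ∀ l, t * y l ≤ (1 + t) * x l := by
    have key : ∀ l, ∀ᶠ t : ℝ in 𝓝[>] 0, t * y l ≤ (1 + t) * x l := fun l => by
      rcases (hx.1.2 l).eq_or_lt with h | h
      · exact Eventually.of_forall fun t => by simp [hxy l h.symm, ← h]
      · have h0 : Tendsto (fun t : ℝ => (1 + t) * x l - t * y l) (𝓝[>] 0) (𝓝 (x l)) := by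
          refine tendsto_nhdsWithin_of_tendsto_nhds ?_
          have : Continuous fun t : ℝ => (1 + t) * x l - t * y l := by fun_prop
          simpa using this.tendsto 0
        filter_upwards [h0.eventually (lt_mem_nhds h)] with t ht
        linarith
    obtain ⟨t, h1, h2⟩ := ((eventually_all.mpr key).and self_mem_nhdsWithin).exists
    exact ⟨t, h2, h1⟩
  set z := (1 + t) • x - t • y with hz
  have hzK : z ∈ feasible A b := by
    have h1 := hx.1.1
    have h2 := hy.1
    refine ⟨?_, fun l => ?_⟩
    · simp only [mulE, hz, map_sub, map_smul] at h1 h2 ⊢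
      rw [h1, h2]; module
    · simpa [hz] using ht1 l
  refine hx.2 hy hzK ⟨t / (1 + t), 1 / (1 + t), by positivity, by positivity, by field_simp; ring, ?_⟩
  rw [hz, smul_sub, smul_smul, smul_smul]
  have : (1 + t) ≠ 0 := by positivity
  rw [one_div, inv_mul_cancel₀ this, div_eq_inv_mul]
  module

/-- An extreme point is determined by its zero set, and there are finitely many zero sets. -/
theorem finite_extremePoints_feasible : ((feasible A b).extremePoints ℝ).Finite := by
  classical
  let supp : EuclideanSpace ℝ (Fin n) → Finset (Fin n) := fun x => {l | x l = 0}
  refine Set.Finite.of_finite_image (f := supp) (Set.toFinite _) fun x hx y hy h => ?_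
  refine (eq_of_support_subset hx hy.1 fun l hl => ?_).symm
  have : l ∈ supp x := by simpa [supp] using hl
  rw [h] at this
  simpa [supp] using this

/-- Krein–Milman; the closure is superfluous because the hull of finitely many points is closed. -/
theorem convexHull_extremePoints_feasible (hbdd : Bornology.IsBounded (feasible A b)) :
    convexHull ℝ ((feasible A b).extremePoints ℝ) = feasible A b := by
  have hK : IsCompact (feasible A b) :=
    Metric.isCompact_of_isClosed_isBounded isClosed_feasible hbdd
  rw [← (finite_extremePoints_feasible.isClosed_convexHull ℝ).closure_eq]
  exact closure_convexHull_extremePoints hK convex_feasible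

end Feasible

/-! ### Entropy of mixtures. -/

section Entropy

variable {n : ℕ}

theorem negMulLog_add_le {a b : ℝ} (ha : 0 ≤ a) (hb : 0 ≤ b) :
    (a + b).negMulLog ≤ a.negMulLog + b.negMulLog := by
  rcases ha.eq_or_lt with rfl | ha
  · simp
  rcases hb.eq_or_lt with rfl | hb
  · simp
  have h1 := mul_le_mul_of_nonneg_left (Real.log_le_log ha (by linarith : a ≤ a + b)) ha.le
  have h2 := mul_le_mul_of_nonneg_left (Real.log_le_log hb (by linarith : b ≤ a + b)) hb.le
  simp only [Real.negMulLog]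
  linarith

/-- The entropy of a mixture exceeds the mixture of the entropies by at most the entropy of the
weights, scaled by the masses. -/
theorem entropy_mix_le {f h : EuclideanSpace ℝ (Fin n)} (hf : ∀ l, 0 ≤ f l) (hh : ∀ l, 0 ≤ h l)
    {s t : ℝ} (hs : 0 ≤ s) (ht : 0 ≤ t) :
    entropy (s • f + t • h) ≤ s * entropy f + t * entropy h +
      s.negMulLog * ∑ l, |f l| + t.negMulLog * ∑ l, |h l| := by
  have key : ∀ l, ((s • f + t • h) l).negMulLog ≤
      s * (f l).negMulLog + t * (h l).negMulLog + s.negMulLog * |f l| + t.negMulLog * |h l| := by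
    intro l
    have := negMulLog_add_le (mul_nonneg hs (hf l)) (mul_nonneg ht (hh l))
    rw [Real.negMulLog_mul, Real.negMulLog_mul] at this
    rw [abs_of_nonneg (hf l), abs_of_nonneg (hh l)]
    simp only [PiLp.add_apply, PiLp.smul_apply, smul_eq_mul]
    linarith
  unfold entropy
  simp only [Finset.mul_sum, ← Finset.sum_add_distrib]
  exact Finset.sum_le_sum fun l _ => key l

theorem entropy_midpoint_lt {x y : EuclideanSpace ℝ (Fin n)} (hx : ∀ l, 0 ≤ x l)
    (hy : ∀ l, 0 ≤ y l) (hxy : x ≠ y) :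
    (1 / 2 : ℝ) * entropy x + (1 / 2 : ℝ) * entropy y <
      entropy ((1 / 2 : ℝ) • x + (1 / 2 : ℝ) • y) := by
  obtain ⟨k, hk⟩ : ∃ k, x k ≠ y k := by
    by_contra! h
    exact hxy (by ext l; exact h l)
  unfold entropy
  simp only [Finset.mul_sum, ← Finset.sum_add_distrib]
  refine Finset.sum_lt_sum (fun l _ => ?_) ⟨k, Finset.mem_univ k, ?_⟩
  · simpa using Real.concaveOn_negMulLog.2 (hx l) (hy l) (by norm_num : (0 : ℝ) ≤ 1 / 2)
      (by norm_num : (0 : ℝ) ≤ 1 / 2) (by norm_num)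
  · simpa using Real.strictConcaveOn_negMulLog.2 (hx k) (hy k) hk
      (by norm_num : (0 : ℝ) < 1 / 2) (by norm_num : (0 : ℝ) < 1 / 2) (by norm_num)

end Entropy

/-! ### The constants `R₁` and `R_H` as upper bounds. -/

section Compact

variable {n : ℕ} {K : Set (EuclideanSpace ℝ (Fin n))}

theorem sum_abs_le_radiusOne (hK : IsCompact K) {x : EuclideanSpace ℝ (Fin n)} (hx : x ∈ K) :
    ∑ l, |x l| ≤ radiusOne K := by
  refine le_csSup ?_ ⟨x, hx, rfl⟩
  have h : Continuous fun x : EuclideanSpace ℝ (Fin n) => ∑ l, |x l| :=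
    continuous_finsetSum _ fun l _ => continuous_abs.comp (by fun_prop)
  refine (hK.bddAbove_image h.continuousOn).mono ?_
  rintro _ ⟨x, hx, rfl⟩
  exact ⟨x, hx, rfl⟩

theorem entropy_sub_le_entropyRange (hK : IsCompact K) {x y : EuclideanSpace ℝ (Fin n)}
    (hx : x ∈ K) (hy : y ∈ K) : entropy x - entropy y ≤ entropyRange K := by
  refine le_csSup ?_ ⟨x, hx, y, hy, rfl⟩
  obtain ⟨M, hM⟩ := hK.bddAbove_image continuous_entropy.continuousOn
  obtain ⟨N, hN⟩ := hK.bddBelow_image continuous_entropy.continuousOn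
  refine ⟨M - N, ?_⟩
  rintro _ ⟨x, hx, y, hy, rfl⟩
  exact sub_le_sub (hM ⟨x, hx, rfl⟩) (hN ⟨y, hy, rfl⟩)

end Compact


/-! ### The penalized minimizer and the gradient. -/

section Minimizer

variable {n r : ℕ} {K : Set (EuclideanSpace ℝ (Fin n))} {c : EuclideanSpace ℝ (Fin n)}
  {B : Matrix (Fin r) (Fin n) ℝ} {ε : ℝ}

/-- The entropically penalized linear cost whose minimum over `K` enters `varObjective`. -/
noncomputable def penalizedCost (c : EuclideanSpace ℝ (Fin n)) (B : Matrix (Fin r) (Fin n) ℝ) (ε : ℝ)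
    (u : EuclideanSpace ℝ (Fin r)) (x : EuclideanSpace ℝ (Fin n)) : ℝ :=
  ⟪c - mulE B.transpose u, x⟫ - ε * entropy x

theorem continuous_penalizedCost :
    Continuous fun p : EuclideanSpace ℝ (Fin r) × EuclideanSpace ℝ (Fin n) =>
      penalizedCost c B ε p.1 p.2 := by
  unfold penalizedCost
  have h1 := (continuous_mulE B.transpose).comp
    (continuous_fst (X := EuclideanSpace ℝ (Fin r)) (Y := EuclideanSpace ℝ (Fin n)))
  have h2 := (continuous_entropy (n := n)).comp
    (continuous_snd (X := EuclideanSpace ℝ (Fin r)) (Y := EuclideanSpace ℝ (Fin n)))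
  exact ((continuous_const.sub h1).inner continuous_snd).sub (continuous_const.mul h2)

theorem penalizedCost_eq_add (u u' : EuclideanSpace ℝ (Fin r)) (x : EuclideanSpace ℝ (Fin n)) :
    penalizedCost c B ε u' x = penalizedCost c B ε u x - ⟪u' - u, mulE B x⟫ := by
  simp only [penalizedCost, inner_reducedCost, inner_sub_left u']
  ring

theorem exists_isMinOn_penalizedCost (hK : IsCompact K) (hne : K.Nonempty)
    (u : EuclideanSpace ℝ (Fin r)) : ∃ x ∈ K, IsMinOn (penalizedCost c B ε u) K x :=
  hK.exists_isMinOn hne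
    (continuous_penalizedCost.comp (Continuous.prodMk_right u)).continuousOn

theorem eq_of_isMinOn_penalizedCost (hconv : Convex ℝ K) (hpos : ∀ x ∈ K, ∀ l, 0 ≤ x l)
    (hε : 0 < ε) {u : EuclideanSpace ℝ (Fin r)} {x y : EuclideanSpace ℝ (Fin n)}
    (hx : x ∈ K) (hy : y ∈ K) (hxm : IsMinOn (penalizedCost c B ε u) K x)
    (hym : IsMinOn (penalizedCost c B ε u) K y) : x = y := by
  by_contra hxy
  have hz : (1 / 2 : ℝ) • x + (1 / 2 : ℝ) • y ∈ K :=
    hconv hx hy (by norm_num) (by norm_num) (by norm_num)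
  have h1 := isMinOn_iff.mp hxm _ hz
  have h2 := isMinOn_iff.mp hym _ hz
  have h3 := mul_lt_mul_of_pos_left (entropy_midpoint_lt (hpos x hx) (hpos y hy) hxy) hε
  simp only [penalizedCost, inner_add_right, inner_smul_right] at h1 h2
  linarith

/-- By joint continuity of the cost, every cluster point of `X` at `u` is a minimizer for `u`, hence
equals `X u`; compactness of `K` turns this into convergence. -/
theorem continuous_of_isMinOn_penalizedCost (hK : IsCompact K) (hconv : Convex ℝ K)
    (hpos : ∀ x ∈ K, ∀ l, 0 ≤ x l) (hε : 0 < ε)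
    {X : EuclideanSpace ℝ (Fin r) → EuclideanSpace ℝ (Fin n)} (hX : ∀ u, X u ∈ K)
    (hmin : ∀ u, IsMinOn (penalizedCost c B ε u) K (X u)) : Continuous X := by
  refine continuous_iff_continuousAt.mpr fun u => ?_
  refine hK.tendsto_nhds_of_unique_mapClusterPt (Eventually.of_forall hX) fun y hy hcl => ?_
  obtain ⟨U, hU, hUy⟩ := mapClusterPt_iff_ultrafilter.mp hcl
  refine eq_of_isMinOn_penalizedCost hconv hpos hε hy (hX u) (isMinOn_iff.mpr fun z hz => ?_)
    (hmin u)
  have hUu : Tendsto (fun u' => u') (U : Filter (EuclideanSpace ℝ (Fin r))) (𝓝 u) := hU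
  refine le_of_tendsto_of_tendsto'
    ((continuous_penalizedCost.tendsto (u, y)).comp (hUu.prodMk_nhds hUy))
    ((continuous_penalizedCost.tendsto (u, z)).comp (hUu.prodMk_nhds tendsto_const_nhds))
    fun u' => isMinOn_iff.mp (hmin u') z hz

theorem varObjective_eq_of_isMinOn {u : EuclideanSpace ℝ (Fin r)}
    {x : EuclideanSpace ℝ (Fin n)} (hx : x ∈ K) (hmin : IsMinOn (penalizedCost c B ε u) K x) :
    varObjective K c B ε u = 1 / 2 * ‖u‖ ^ 2 + penalizedCost c B ε u x := by
  have h : IsLeast (penalizedCost c B ε u '' K) (penalizedCost c B ε u x) := by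
    refine ⟨⟨x, hx, rfl⟩, ?_⟩
    rintro _ ⟨z, hz, rfl⟩
    exact isMinOn_iff.mp hmin z hz
  exact congrArg _ h.csInf_eq

/-- The envelope theorem for the entropically penalized linear program. -/
theorem hasGradientAt_varObjective
    {X : EuclideanSpace ℝ (Fin r) → EuclideanSpace ℝ (Fin n)} (hX : ∀ u, X u ∈ K)
    (hmin : ∀ u, IsMinOn (penalizedCost c B ε u) K (X u)) (hcont : Continuous X)
    (u : EuclideanSpace ℝ (Fin r)) :
    HasGradientAt (varObjective K c B ε) (u - mulE B (X u)) u := by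
  rw [hasGradientAt_iff_isLittleO, Asymptotics.isLittleO_iff]
  intro κ hκ
  have hlim : Tendsto (fun u' => 1 / 2 * ‖u' - u‖ + ‖mulE B (X u') - mulE B (X u)‖) (𝓝 u)
      (𝓝 0) := by
    have h1 := (continuous_mulE B).comp hcont
    have : Continuous fun u' => 1 / 2 * ‖u' - u‖ + ‖mulE B (X u') - mulE B (X u)‖ :=
      (by fun_prop : Continuous fun u' => 1 / 2 * ‖u' - u‖).add (h1.sub continuous_const).norm
    simpa using this.tendsto u
  filter_upwards [hlim.eventually (gt_mem_nhds hκ)] with u' hu'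
  rw [varObjective_eq_of_isMinOn (hX u') (hmin u'), varObjective_eq_of_isMinOn (hX u) (hmin u)]
  -- Testing each minimizer against the other sandwiches the change in the minimum between two
  -- linear terms whose slopes differ by `B (X u') - B (X u)`.
  have h1 := isMinOn_iff.mp (hmin u') _ (hX u)
  have h2 := isMinOn_iff.mp (hmin u) _ (hX u')
  have h3 := penalizedCost_eq_add (c := c) (B := B) (ε := ε) u u' (X u)
  have h4 := penalizedCost_eq_add (c := c) (B := B) (ε := ε) u u' (X u')
  have h5 : 1 / 2 * ‖u'‖ ^ 2 - 1 / 2 * ‖u‖ ^ 2 - ⟪u, u' - u⟫ = 1 / 2 * ‖u' - u‖ ^ 2 := by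
    rw [norm_sub_sq_real, inner_sub_right, real_inner_self_eq_norm_sq, real_inner_comm]
    ring
  have h6 : |⟪u' - u, mulE B (X u') - mulE B (X u)⟫| ≤
      ‖u' - u‖ * ‖mulE B (X u') - mulE B (X u)‖ := abs_real_inner_le_norm _ _
  have h7 : ‖u' - u‖ * (1 / 2 * ‖u' - u‖ + ‖mulE B (X u') - mulE B (X u)‖) ≤ ‖u' - u‖ * κ :=
    mul_le_mul_of_nonneg_left hu'.le (norm_nonneg _)
  rw [inner_sub_right] at h6
  have h8 := abs_le.mp h6
  have h9 : 0 ≤ ‖u' - u‖ ^ 2 := by positivity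
  rw [Real.norm_eq_abs, abs_le, inner_sub_left u, real_inner_comm (u' - u) (mulE B (X u))]
  constructor <;> nlinarith

end Minimizer


/-- Otherwise the interior of `t` and the complement of its closure would separate `s`. -/
theorem inter_frontier_nonempty_of_isPreconnected {α : Type*} [TopologicalSpace α] {s t : Set α}
    (hs : IsPreconnected s) (h : (s ∩ t).Nonempty) (h' : (s ∩ tᶜ).Nonempty) :
    (s ∩ frontier t).Nonempty := by
  by_contra! hempty
  have hnot : ∀ z ∈ s, z ∉ frontier t := fun z hz hzf => by
    have : z ∈ s ∩ frontier t := ⟨hz, hzf⟩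
    simp [hempty] at this
  have hint : ∀ z ∈ s, z ∈ t → z ∈ interior t := fun z hz hzt => by
    by_contra hzi
    exact hnot z hz ⟨subset_closure hzt, hzi⟩
  have hext : ∀ z ∈ s, z ∉ t → z ∈ (closure t)ᶜ := fun z hz hzt hzc =>
    hnot z hz ⟨hzc, fun hzi => hzt (interior_subset hzi)⟩
  obtain ⟨y, hy, hyt⟩ := h
  obtain ⟨w, hw, hwt⟩ := h'
  obtain ⟨z, -, hz, hz'⟩ := hs (interior t) (closure t)ᶜ isOpen_interior isClosed_closure.isOpen_compl
    (fun z hz => (em (z ∈ t)).imp (hint z hz) (hext z hz)) ⟨y, hy, hint y hy hyt⟩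
    ⟨w, hw, hext w hw hwt⟩
  exact hz' (subset_closure (interior_subset hz))

/-! ### Optimality regions, gaps and concentration of the minimizer. -/

section Region

variable {n r : ℕ} {K : Set (EuclideanSpace ℝ (Fin n))} {c : EuclideanSpace ℝ (Fin n)}
  {B : Matrix (Fin r) (Fin n) ℝ} {v : EuclideanSpace ℝ (Fin n)}

/-- A point of the region at distance at least `γ` from its boundary is the centre of a ball of
radius `γ` contained in the region. -/
theorem ball_subset_region {u : EuclideanSpace ℝ (Fin r)} {γ : ℝ} (hu : u ∈ region K c B v)
    (hd : ENNReal.ofReal γ ≤ bdDist K c B v u) : Metric.ball u γ ⊆ region K c B v := by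
  intro y hy
  by_contra hyR
  have hγ : 0 < γ := Metric.pos_of_mem_ball hy
  obtain ⟨z, hz, hzf⟩ := inter_frontier_nonempty_of_isPreconnected
    (t := region K c B v) (convex_ball u γ).isPreconnected ⟨u, Metric.mem_ball_self hγ, hu⟩ ⟨y, hy, hyR⟩
  have h1 : edist u z < ENNReal.ofReal γ := by
    rw [edist_comm, edist_dist]
    exact (ENNReal.ofReal_lt_ofReal_iff hγ).mpr hz
  exact absurd (hd.trans (Metric.infEDist_le_edist_of_mem hzf)) (not_le.mpr h1)

/-- The suboptimality of a vertex with a different image is at least proportional to the distance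
of the images. -/
theorem mul_norm_le_inner_reducedCost {u : EuclideanSpace ℝ (Fin r)} {γ : ℝ} (hγ : 0 < γ)
    (hball : Metric.ball u γ ⊆ region K c B v) {w : EuclideanSpace ℝ (Fin n)}
    (hw : w ∈ K.extremePoints ℝ) (hwv : mulE B w ≠ mulE B v) :
    γ * ‖mulE B w - mulE B v‖ ≤ ⟪c - mulE B.transpose u, w - v⟫ := by
  set d := mulE B w - mulE B v with hd
  have hd0 : 0 < ‖d‖ := norm_pos_iff.mpr (sub_ne_zero.mpr hwv)
  -- Moving `u` by length `t` along `d` lowers the cost difference of `w` and `v` by `t * ‖d‖`, yet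
  -- `v` stays optimal.
  have key : ∀ t ∈ Set.Ioo 0 γ, t * ‖d‖ ≤ ⟪c - mulE B.transpose u, w - v⟫ := by
    intro t ht
    have hmem : u + (t / ‖d‖) • d ∈ Metric.ball u γ := by
      rw [Metric.mem_ball, dist_eq_norm, add_sub_cancel_left, norm_smul, Real.norm_eq_abs,
        abs_of_pos (div_pos ht.1 hd0), div_mul_cancel₀ _ hd0.ne']
      exact ht.2
    have h := hball hmem w hw
    have h2 : ⟪(t / ‖d‖) • d, d⟫ = t * ‖d‖ := by
      rw [real_inner_smul_left, real_inner_self_eq_norm_sq]; field_simp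
    have h3 : ⟪(t / ‖d‖) • d, d⟫ =
        ⟪(t / ‖d‖) • d, mulE B w⟫ - ⟪(t / ‖d‖) • d, mulE B v⟫ := by
      rw [hd, inner_sub_right]
    simp only [inner_reducedCost, inner_add_left] at h
    simp only [inner_sub_right, inner_reducedCost]
    linarith
  -- The ball is open, so `t = γ` is reached as a limit: a `t` between `a / ‖d‖` and `γ` contradicts
  -- `key`.
  by_contra! hlt
  have h1 := key (γ / 2) ⟨by linarith, by linarith⟩
  set a := ⟪c - mulE B.transpose u, w - v⟫
  have ha : 0 < a := lt_of_lt_of_le (by positivity) h1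
  have h2 : a / ‖d‖ < γ := (div_lt_iff₀ hd0).mpr hlt
  have h3 := key ((a / ‖d‖ + γ) / 2) ⟨by positivity, by linarith⟩
  have h4 : a = a / ‖d‖ * ‖d‖ := by field_simp
  nlinarith

/-- Vertices outside the face on which both `B` and `c` are constant are suboptimal by more than
`ε * M`, provided `ε < gapConst * M⁻¹`. -/
theorem lt_inner_reducedCost_of_lt_gapConst {u : EuclideanSpace ℝ (Fin r)} {γ ε M : ℝ}
    (hγ : 0 < γ) (hM : 0 < M) (hε : (ε : EReal) < gapConst K c B v γ * ((M⁻¹ : ℝ) : EReal))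
    (hball : Metric.ball u γ ⊆ region K c B v) {w : EuclideanSpace ℝ (Fin n)}
    (hw : w ∈ K.extremePoints ℝ) (hwv : ¬(mulE B w = mulE B v ∧ ⟪c, w⟫ = ⟪c, v⟫)) :
    ε * M < ⟪c - mulE B.transpose u, w - v⟫ := by
  -- Only real upper bounds of `gapConst` matter, so its possible value `⊤` needs no separate case.
  have hreal : ∀ a : ℝ, gapConst K c B v γ ≤ (a : EReal) → ε * M < a := by
    intro a ha
    have h1 : (ε : EReal) < (a : EReal) * ((M⁻¹ : ℝ) : EReal) :=
      hε.trans_le (mul_le_mul_of_nonneg_right ha (by exact_mod_cast (inv_pos.mpr hM).le))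
    have h2 : ε < a * M⁻¹ := by exact_mod_cast h1
    rwa [← div_eq_mul_inv, lt_div_iff₀ hM] at h2
  by_cases hB : mulE B w = mulE B v
  · have hc : ⟪c, w⟫ ≠ ⟪c, v⟫ := fun h => hwv ⟨hB, h⟩
    have h1 := hreal ⟪c, w - v⟫ ((min_le_right _ _).trans (iInf₂_le w ⟨hw, hB, hc⟩))
    rw [inner_sub_right] at h1
    simp only [inner_sub_right, inner_reducedCost, hB]
    linarith
  · have h1 := hreal (γ * ‖mulE B w - mulE B v‖)
      ((min_le_left _ _).trans (iInf₂_le w ⟨hw, hB⟩))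
    exact h1.trans_le (mul_norm_le_inner_reducedCost hγ hball hw hB)

/-- If the mass `t` of the suboptimal part of a penalized minimizer is positive, then the gap is
controlled by `log t`. -/
theorem inner_reducedCost_le_of_isMinOn (hK : IsCompact K) (hpos : ∀ x ∈ K, ∀ l, 0 ≤ x l)
    {ε : ℝ} (hε : 0 < ε) {u : EuclideanSpace ℝ (Fin r)} {f h : EuclideanSpace ℝ (Fin n)}
    (hf : f ∈ K) (hh : h ∈ K) {s t : ℝ} (hs : 0 ≤ s) (ht : 0 < t) (hst : s + t = 1)
    (hmin : IsMinOn (penalizedCost c B ε u) K (s • f + t • h)) :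
    ⟪c - mulE B.transpose u, h - f⟫ ≤
      ε * (radiusOne K + entropyRange K - radiusOne K * Real.log t) := by
  have h1 := isMinOn_iff.mp hmin f hf
  have h2 := entropy_mix_le (hpos f hf) (hpos h hh) hs ht.le
  -- The weight `s` contributes the summand `R₁` of the bound, the weight `t` the summand `-R₁ log
  -- t`.
  have h3 : s.negMulLog ≤ t := by
    have := Real.negMulLog_le_one_sub_self hs
    linarith
  have h4 : 0 ≤ t.negMulLog := Real.negMulLog_nonneg ht.le (by linarith)
  have h5 := sum_abs_le_radiusOne hK hf
  have h6 := sum_abs_le_radiusOne hK hh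
  have h7 := entropy_sub_le_entropyRange hK hh hf
  have hf0 : 0 ≤ ∑ l, |f l| := Finset.sum_nonneg fun _ _ => abs_nonneg _
  have h8 : s.negMulLog * ∑ l, |f l| ≤ t * radiusOne K := mul_le_mul h3 h5 hf0 ht.le
  have h9 : t.negMulLog * ∑ l, |h l| ≤ t.negMulLog * radiusOne K :=
    mul_le_mul_of_nonneg_left h6 h4
  have h10 := mul_le_mul_of_nonneg_left h7 ht.le
  have hs1 : s = 1 - t := by linarith
  have h11 : entropy (s • f + t • h) - entropy f ≤
      t * (radiusOne K + entropyRange K - radiusOne K * Real.log t) := by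
    have : s * entropy f = entropy f - t * entropy f := by rw [hs1]; ring
    simp only [Real.negMulLog] at h2 h8 h9
    linarith
  have h12 := mul_le_mul_of_nonneg_left h11 hε.le
  simp only [penalizedCost, inner_add_right, inner_smul_right] at h1
  rw [inner_sub_right]
  set p := ⟪c - mulE B.transpose u, f⟫
  set q := ⟪c - mulE B.transpose u, h⟫
  have h13 : s * p = p - t * p := by rw [hs1]; ring
  refine le_of_mul_le_mul_left ?_ ht
  linarith

theorem norm_mulE_sub_le (hK : IsCompact K) {x y : EuclideanSpace ℝ (Fin n)} (hx : x ∈ K)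
    (hy : y ∈ K) : ‖mulE B x - mulE B y‖ ≤ opNorm B * (2 * radiusOne K) := by
  rw [← map_sub]
  refine (norm_mulE_le B _).trans (mul_le_mul_of_nonneg_left ?_ (opNorm_nonneg B))
  have h1 := (norm_le_sum_abs x).trans (sum_abs_le_radiusOne hK hx)
  have h2 := (norm_le_sum_abs y).trans (sum_abs_le_radiusOne hK hy)
  linarith [norm_sub_le x y]

/-- Well inside the region of `v`, the image of the penalized minimizer is close to that of `v`. -/
theorem norm_mulE_minimizer_sub_lt (hK : IsCompact K) (hconv : Convex ℝ K)
    (hhull : convexHull ℝ (K.extremePoints ℝ) = K) (hpos : ∀ x ∈ K, ∀ l, 0 ≤ x l)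
    (hv : v ∈ K.extremePoints ℝ) {γ δ ε : ℝ} (hγ : 0 < γ) (hδ : 0 < δ)
    (hδ' : δ < 4 * opNorm B * radiusOne K) (hε : 0 < ε)
    (hε' : (ε : EReal) < gapConst K c B v γ *
      (((radiusOne K + entropyRange K
        - radiusOne K * Real.log (δ / (4 * opNorm B * radiusOne K)))⁻¹ : ℝ) : EReal))
    {u : EuclideanSpace ℝ (Fin r)} (hball : Metric.ball u γ ⊆ region K c B v)
    {x : EuclideanSpace ℝ (Fin n)} (hx : x ∈ K) (hmin : IsMinOn (penalizedCost c B ε u) K x) :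
    ‖mulE B x - mulE B v‖ < δ / 2 := by
  have hR0 : 0 ≤ radiusOne K :=
    (Finset.sum_nonneg fun _ _ => abs_nonneg _).trans (sum_abs_le_radiusOne hK hx)
  have hP : 0 < 4 * opNorm B * radiusOne K := hδ.trans hδ'
  have hR : 0 < radiusOne K := hR0.lt_of_ne fun h => by simp [← h] at hP
  have hH : 0 ≤ entropyRange K := by
    simpa using entropy_sub_le_entropyRange hK hx hx
  -- Threshold for the mass `t`: images of points of `K` are at most `2 * opNorm B * radiusOne K`
  -- apart, so mass below `η` moves the image by less than `δ / 2`.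
  set η := δ / (4 * opNorm B * radiusOne K) with hη
  have hη0 : 0 < η := div_pos hδ hP
  have hη1 : η < 1 := (div_lt_one hP).mpr hδ'
  have hlog : 0 < -(radiusOne K * Real.log η) := by
    have := mul_pos_of_neg_of_neg (Real.log_neg hη0 hη1) (neg_neg_of_pos hR)
    linarith
  set M := radiusOne K + entropyRange K - radiusOne K * Real.log η with hM
  have hM0 : 0 < M := by linarith
  let P : EuclideanSpace ℝ (Fin n) → Prop := fun w => mulE B w = mulE B v ∧ ⟪c, w⟫ = ⟪c, v⟫
  have hconvP : Convex ℝ {w | P w} := by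
    rintro y ⟨hy1, hy2⟩ z ⟨hz1, hz2⟩ s t hs ht hst
    refine ⟨?_, ?_⟩
    · simp only [mulE, map_add, map_smul] at hy1 hz1 ⊢
      rw [hy1, hz1, ← add_smul, hst, one_smul]
    · rw [inner_add_right, inner_smul_right, inner_smul_right, hy2, hz2, ← add_mul, hst, one_mul]
  have hfaceP : ∀ f ∈ convexHull ℝ {w ∈ K.extremePoints ℝ | P w}, P f := fun f hf =>
    convexHull_min (fun w hw => hw.2) hconvP hf
  have hsub : ∀ Q : EuclideanSpace ℝ (Fin n) → Prop,
      convexHull ℝ {w ∈ K.extremePoints ℝ | Q w} ⊆ K := fun Q =>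
    convexHull_min (fun w hw => hw.1.1) hconv
  have hrest : ∀ h ∈ convexHull ℝ {w ∈ K.extremePoints ℝ | ¬P w},
      ε * M < ⟪c - mulE B.transpose u, h - v⟫ := by
    have hcv : Convex ℝ {h | ε * M < ⟪c - mulE B.transpose u, h - v⟫} := by
      have : {h | ε * M < ⟪c - mulE B.transpose u, h - v⟫} =
          {h | ε * M + ⟪c - mulE B.transpose u, v⟫ < ⟪c - mulE B.transpose u, h⟫} := by
        ext h
        simp only [Set.mem_ofPred_eq, inner_sub_right]
        exact lt_sub_iff_add_lt
      rw [this]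
      exact convex_halfSpace_gt (innerₛₗ ℝ (c - mulE B.transpose u)).isLinear _
    exact fun h hh => convexHull_min
      (fun w hw => lt_inner_reducedCost_of_lt_gapConst hγ hM0 hε' hball hw.1 hw.2) hcv hh
  have hunion : K.extremePoints ℝ =
      {w ∈ K.extremePoints ℝ | P w} ∪ {w ∈ K.extremePoints ℝ | ¬P w} := by
    ext w
    simp only [Set.mem_union, Set.mem_ofPred_eq]
    tauto
  have hxh : x ∈ convexHull ℝ (K.extremePoints ℝ) := hhull.symm ▸ hx
  rw [hunion] at hxh
  rcases Set.eq_empty_or_nonempty {w ∈ K.extremePoints ℝ | ¬P w} with hE | hE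
  · rw [hE, Set.union_empty] at hxh
    rw [(hfaceP x hxh).1, sub_self, norm_zero]
    linarith
  have hF : {w ∈ K.extremePoints ℝ | P w}.Nonempty := ⟨v, hv, rfl, rfl⟩
  rw [convexHull_union hF hE, mem_convexJoin] at hxh
  obtain ⟨f, hf, h, hh, s, t, hs, ht, hst, rfl⟩ := hxh
  have hfP := hfaceP f hf
  have hfK := hsub _ hf
  have hhK := hsub _ hh
  have htη : t < η := by
    by_contra! hle
    have ht0 := hη0.trans_le hle
    have h1 := inner_reducedCost_le_of_isMinOn hK hpos hε hfK hhK hs ht0 hst hmin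
    have h2 := hrest h hh
    have h3 : ⟪c - mulE B.transpose u, h - f⟫ = ⟪c - mulE B.transpose u, h - v⟫ := by
      simp only [inner_sub_right, inner_reducedCost, hfP.1, hfP.2]
    have h4 := mul_le_mul_of_nonneg_left (Real.log_le_log hη0 hle) hR0
    have h5 : ε * (radiusOne K + entropyRange K - radiusOne K * Real.log t) ≤ ε * M :=
      mul_le_mul_of_nonneg_left (by linarith) hε.le
    linarith
  have heq : mulE B (s • f + t • h) - mulE B v = t • (mulE B h - mulE B v) := by
    have h1 := hfP.1
    simp only [mulE, map_add, map_smul] at h1 ⊢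
    rw [h1, show s = 1 - t by linarith]
    module
  rw [heq, norm_smul, Real.norm_eq_abs, abs_of_nonneg ht]
  have hOp : 0 < opNorm B * (2 * radiusOne K) := by linarith
  calc t * ‖mulE B h - mulE B v‖ ≤ t * (opNorm B * (2 * radiusOne K)) :=
        mul_le_mul_of_nonneg_left (norm_mulE_sub_le hK hhK hv.1) ht
    _ < η * (opNorm B * (2 * radiusOne K)) := mul_lt_mul_of_pos_right htη hOp
    _ = δ / 2 := by
        rw [hη, div_mul_eq_mul_div, div_eq_div_iff hP.ne' two_ne_zero]
        ring

theorem bdDist_le_add (y u : EuclideanSpace ℝ (Fin r)) :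
    bdDist K c B v y ≤ bdDist K c B v u + ENNReal.ofReal ‖u - y‖ := by
  have := Metric.infEDist_le_infEDist_add_edist (x := y) (y := u)
    (s := frontier (region K c B v))
  rwa [edist_comm, edist_dist, dist_eq_norm] at this

end Region

end EntropicQP

theorem proposition3 {m n r : ℕ}
    (A : Matrix (Fin m) (Fin n) ℝ) (b : EuclideanSpace ℝ (Fin m))
    (c : EuclideanSpace ℝ (Fin n)) (B : Matrix (Fin r) (Fin n) ℝ)
    (K : Set (EuclideanSpace ℝ (Fin n))) (hK : K = feasible A b)
    (hne : K.Nonempty) (hbdd : Bornology.IsBounded K)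
    (hnontriv : ∃ x ∈ K, ∃ y ∈ K, quadObjective c B x ≠ quadObjective c B y)
    (v : EuclideanSpace ℝ (Fin n)) (hv : v ∈ K.extremePoints ℝ)
    (γ δ ε : ℝ) (hγ : 0 < γ) (hδ : 0 < δ) (hδ' : δ < 4 * opNorm B * radiusOne K)
    (hε : 0 < ε)
    (hε' : (ε : EReal) < gapConst K c B v γ *
      (((radiusOne K + entropyRange K
        - radiusOne K * Real.log (δ / (4 * opNorm B * radiusOne K)))⁻¹ : ℝ) : EReal)) :
    -- the gradients below are genuine
    Differentiable ℝ (varObjective K c B ε) ∧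
    -- first item
    (mulE B v ∈ interior (region K c B v) →
      ENNReal.ofReal γ < bdDist K c B v (mulE B v) / 2 →
      ENNReal.ofReal δ < bdDist K c B v (mulE B v) →
        (∀ u ∈ region K c B v, ‖u - mulE B v‖ ≤ δ / 2 →
          ‖gradient (varObjective K c B ε) u‖ ≤ δ) ∧
        (∀ u ∈ region K c B v, ‖gradient (varObjective K c B ε) u‖ ≤ δ →
          (ENNReal.ofReal γ ≤ bdDist K c B v u ∧ ‖u - mulE B v‖ < 3 * δ / 2) ∨
            bdDist K c B v u < ENNReal.ofReal γ) ∧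
        (ENNReal.ofReal δ < bdDist K c B v (mulE B v) / 3 →
          Disjoint {u | ‖u - mulE B v‖ < 3 * δ / 2}
            {u | bdDist K c B v u < ENNReal.ofReal γ})) ∧
    -- second item
    (mulE B v ∉ interior (region K c B v) → δ ≤ 2 / 3 * γ →
      ∀ u ∈ region K c B v, ‖gradient (varObjective K c B ε) u‖ ≤ δ →
        bdDist K c B v u < ENNReal.ofReal γ) := by
  have hcomp : IsCompact K :=
    Metric.isCompact_of_isClosed_isBounded (hK ▸ isClosed_feasible) hbdd
  have hconv : Convex ℝ K := hK ▸ convex_feasible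
  have hpos : ∀ x ∈ K, ∀ l, 0 ≤ x l := by
    intro x hx
    rw [hK] at hx
    exact hx.2
  have hhull : convexHull ℝ (K.extremePoints ℝ) = K := by
    rw [hK] at hbdd ⊢
    exact convexHull_extremePoints_feasible hbdd
  choose X hX hmin using
    exists_isMinOn_penalizedCost (c := c) (B := B) (ε := ε) hcomp hne
  have hcont := continuous_of_isMinOn_penalizedCost hcomp hconv hpos hε hX hmin
  have hgrad := hasGradientAt_varObjective hX hmin hcont
  have hgap : ∀ u ∈ region K c B v, ENNReal.ofReal γ ≤ bdDist K c B v u →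
      ‖mulE B (X u) - mulE B v‖ < δ / 2 := fun u hu hd =>
    norm_mulE_minimizer_sub_lt hcomp hconv hhull hpos hv hγ hδ hδ' hε hε'
      (ball_subset_region hu hd) (hX u) (hmin u)
  have hnear : ∀ u ∈ region K c B v, ENNReal.ofReal γ ≤ bdDist K c B v u →
      ‖gradient (varObjective K c B ε) u‖ ≤ δ → ‖u - mulE B v‖ < 3 * δ / 2 := by
    intro u hu hd hg
    rw [(hgrad u).gradient] at hg
    have := norm_sub_le_norm_sub_add_norm_sub u (mulE B (X u)) (mulE B v)
    linarith [hgap u hu hd]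
  have hdist : ∀ u, bdDist K c B v u < ENNReal.ofReal γ →
      bdDist K c B v (mulE B v) < ENNReal.ofReal (γ + ‖u - mulE B v‖) := by
    intro u hu
    rw [ENNReal.ofReal_add hγ.le (norm_nonneg _)]
    exact (bdDist_le_add _ u).trans_lt (ENNReal.add_lt_add_right ENNReal.ofReal_ne_top hu)
  have hlt : ∀ {a k : ℝ} {D : ENNReal}, 0 ≤ a → 0 < k →
      ENNReal.ofReal a < D / ENNReal.ofReal k → ENNReal.ofReal (a * k) < D := by
    intro a k D ha hk h
    rw [ENNReal.ofReal_mul ha]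
    exact (ENNReal.lt_div_iff_mul_lt (Or.inl (by simpa using hk))
      (Or.inl ENNReal.ofReal_ne_top)).mp h
  refine ⟨fun u => (hgrad u).differentiableAt, fun _ hγD hδD => ⟨?_, ?_, ?_⟩, ?_⟩
  · intro u hu hud
    -- Otherwise `D < γ + δ / 2`, while `2 γ < D` and `δ < D` would give both `γ < δ / 2` and `δ / 2
    -- < γ`.
    have hd : ENNReal.ofReal γ ≤ bdDist K c B v u := by
      by_contra! hlt'
      have h1 := hdist u hlt'
      have h2 := hlt hγ.le two_pos (by simpa using hγD)
      have h3 := (ENNReal.ofReal_lt_ofReal_iff (by positivity)).mp (h2.trans h1)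
      have h4 := (ENNReal.ofReal_lt_ofReal_iff (by positivity)).mp (hδD.trans h1)
      linarith
    rw [(hgrad u).gradient]
    have h1 := norm_sub_le_norm_sub_add_norm_sub u (mulE B v) (mulE B (X u))
    rw [norm_sub_rev (mulE B v)] at h1
    linarith [hgap u hu hd]
  · intro u hu hg
    rcases le_or_gt (ENNReal.ofReal γ) (bdDist K c B v u) with hd | hd
    · exact Or.inl ⟨hd, hnear u hu hd hg⟩
    · exact Or.inr hd
  · intro hδ3
    refine Set.disjoint_left.mpr fun u hu hd => ?_
    have hu' : ‖u - mulE B v‖ < 3 * δ / 2 := hu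
    have h1 := hdist u hd
    have h2 := hlt hγ.le two_pos (by simpa using hγD)
    have h2' := hlt hδ.le three_pos (by simpa using hδ3)
    have h3 := (ENNReal.ofReal_lt_ofReal_iff (by positivity)).mp (h2.trans h1)
    have h4 := (ENNReal.ofReal_lt_ofReal_iff (by positivity)).mp (h2'.trans h1)
    -- `2 γ < D < γ + 3 δ / 2` gives `γ < 3 δ / 2`, whence `D < 3 δ`, contrary to `3 δ < D`.
    linarith
  · intro hint hδγ u hu hg
    by_contra! hd
    -- Since `3 δ / 2 ≤ γ`, the ball of radius `γ` about `u` contains `B v`, making it interior.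
    refine hint (interior_maximal (ball_subset_region hu hd) Metric.isOpen_ball ?_)
    rw [Metric.mem_ball, dist_comm, dist_eq_norm]
    linarith [hnear u hu hd hg]
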